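/- Let $k\ge 2$ and let $H$ be a finite $k$-uniform hypergraph (a set $E(H)$ of $k$-element subsets of a vertex set identified with $[n]=\{1,\dots,n\}$), and let $d_1,\dots,d_n$ be its vertex degrees. Let $\mathcal A_H$ be the order $k$, dimension $n$ adjacency tensor, with entry $\frac{1}{(k-1)!}$ at $(i_1,\dots,i_k)$ if $\{i_1,\dots,i_k\}\in E(H)$ and $0$ otherwise; let $\mathcal D_H$ be the order $k$ diagonal tensor with diagonal entries $d_1,\dots,d_n$; and let $\mathcal L_H=\mathcal D_H-\mathcal A_H$ and $\mathcal Q_H=\mathcal D_H+\mathcal A_H$. For an order $k$, dimension $n$ complex tensor $\mathcal T=(t_{i_1\cdots i_k})$ and $d\ge 1$, the $d$-th order trace is $$\mathrm{Tr}_d(\mathcal T)=(k-1)^{n-1}\sum_{\substack{m_1+\cdots+m_n=d\\ m_i\ge 0}}\ \prod_{i=1}^n\frac{1}{(m_i(k-1))!}\Big(\sum_{y\in[n]^{k-1}}t_{iy}\frac{\partial}{\partial a_{iy}}\Big)^{m_i}\operatorname{tr}\big(A^{d(k-1)}\big),$$ where $A=(a_{ij})$ is an $n\times n$ matrix of independent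 variables and $\frac{\partial}{\partial a_{iy}}=\frac{\partial}{\partial a_{ii_2}}\cdots\frac{\partial}{\partial a_{ii_k}}$ for $y=(i_2,\dots,i_k)$. Then $$\mathrm{Tr}_t(\mathcal L_H)=\mathrm{Tr}_t(\mathcal Q_H)=(k-1)^{n-1}\sum_{i=1}^n d_i^t\qquad (t=1,\dots,k-1),$$ $$\mathrm{Tr}_k(\mathcal L_H)=(-1)^k k^{k-1}(k-1)^{n-k}|E(H)|+(k-1)^{n-1}\sum_{i=1}^n d_i^k,$$ $$\mathrm{Tr}_k(\mathcal Q_H)=k^{k-1}(k-1)^{n-k}|E(H)|+(k-1)^{n-1}\sum_{i=1}^n d_i^k.$$ -/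

import Mathlib

open scoped Nat

noncomputable section

/-- Complex tensors of order `k` with index set `V` (so of dimension `|V|`). The entry
`t_{i i₂ ⋯ i_k}` of `T` is `T i y` with `y = (i₂, …, i_k)`. -/
abbrev Tensor (k : ℕ) (V : Type*) : Type _ := V → (Fin (k - 1) → V) → ℂ

namespace Tensor

variable {k : ℕ} {V : Type*}

/-- `∂/∂a_{iy} = ∂/∂a_{i i₂} ⋯ ∂/∂a_{i i_k}` for `y = (i₂, …, i_k)`, acting on polynomials in the
entries `a_{uv}` of an auxiliary `V × V` matrix. -/
def partialOp (i : V) (y : Fin (k - 1) → V) : Module.End ℂ (MvPolynomial (V × V) ℂ) :=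
  (List.ofFn fun j => ((MvPolynomial.pderiv (i, y j) :
    Derivation ℂ (MvPolynomial (V × V) ℂ) (MvPolynomial (V × V) ℂ)) :
      Module.End ℂ (MvPolynomial (V × V) ℂ))).prod

/-- The differential operator `∑_y t_{iy} ∂/∂a_{iy}`. -/
def rowOp [Fintype V] (T : Tensor k V) (i : V) : Module.End ℂ (MvPolynomial (V × V) ℂ) :=
  ∑ y : Fin (k - 1) → V, T i y • partialOp i y

theorem pderiv_commute {σ : Type*} (a b : σ) :
    Commute
      ((MvPolynomial.pderiv a : Derivation ℂ (MvPolynomial σ ℂ) (MvPolynomial σ ℂ)) :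
        Module.End ℂ (MvPolynomial σ ℂ))
      ((MvPolynomial.pderiv b : Derivation ℂ (MvPolynomial σ ℂ) (MvPolynomial σ ℂ)) :
        Module.End ℂ (MvPolynomial σ ℂ)) := by
  classical
  have h : ⁅(MvPolynomial.pderiv a : Derivation ℂ (MvPolynomial σ ℂ) (MvPolynomial σ ℂ)),
      (MvPolynomial.pderiv b : Derivation ℂ (MvPolynomial σ ℂ) (MvPolynomial σ ℂ))⁆ = 0 := by
    apply MvPolynomial.derivation_ext
    intro i
    simp only [Derivation.commutator_apply, MvPolynomial.pderiv_X, Pi.single_apply]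
    split_ifs <;> simp
  refine LinearMap.ext fun p => ?_
  have hp := congrArg
    (fun D : Derivation ℂ (MvPolynomial σ ℂ) (MvPolynomial σ ℂ) => D p) h
  simp only [Derivation.commutator_apply, Derivation.coe_zero, Pi.zero_apply] at hp
  exact sub_eq_zero.mp hp

theorem rowOp_commute [Fintype V] (T : Tensor k V) (i j : V) :
    Commute (rowOp T i) (rowOp T j) := by
  refine Commute.sum_left _ _ _ fun y _ => Commute.sum_right _ _ _ fun z _ => ?_
  refine (Commute.smul_left ?_ _).smul_right _
  refine Commute.list_prod_left _ _ fun f hf => Commute.list_prod_right _ _ fun g hg => ?_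
  obtain ⟨a, rfl⟩ := List.mem_ofFn' _ _ |>.mp hf
  obtain ⟨b, rfl⟩ := List.mem_ofFn' _ _ |>.mp hg
  exact pderiv_commute _ _

/-- The operator `∏_i (1 / (m_i (k-1))!) (∑_y t_{iy} ∂/∂a_{iy})^{m_i}`; its factors commute. -/
def traceOp [Fintype V] (T : Tensor k V) (m : V → ℕ) :
    Module.End ℂ (MvPolynomial (V × V) ℂ) :=
  Finset.univ.noncommProd (fun i => (1 / ((m i * (k - 1))! : ℂ)) • rowOp T i ^ m i)
    fun i _ j _ _ => (((rowOp_commute T i j).pow_pow _ _).smul_left _).smul_right _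

/-- The `d`-th order trace
`Tr_d(T) = (k-1)^{n-1} ∑_{m_1+⋯+m_n=d} ∏_i (1 / (m_i (k-1))!) (∑_y t_{iy} ∂/∂a_{iy})^{m_i}
tr(A^{d(k-1)})`, where `A = (a_{uv})` is the generic matrix. The operators have order `d(k-1)` and
`tr(A^{d(k-1)})` is homogeneous of the same degree, so what they produce is a constant polynomial,
which `MvPolynomial.constantCoeff` reads off as a complex number. -/
def trace [Fintype V] [DecidableEq V] (d : ℕ) (T : Tensor k V) : ℂ :=
  ((k : ℂ) - 1) ^ ((Fintype.card V : ℤ) - 1) *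
    MvPolynomial.constantCoeff
      (∑ m ∈ Finset.piAntidiag (Finset.univ : Finset V) d,
        traceOp T m (Matrix.trace (Matrix.mvPolynomialX V V ℂ ^ (d * (k - 1)))))

end Tensor

namespace Hypergraph

variable {α : Type*}

/-- Every edge consists of exactly `k` distinct vertices. -/
def IsUniform (H : Hypergraph α) (k : ℕ) : Prop :=
  ∀ e ∈ H.edgeSet, e.Finite ∧ e.ncard = k

/-- The degree of a vertex: the number of edges that contain it. -/
def degree (H : Hypergraph α) (v : α) : ℕ :=
  {e ∈ H.edgeSet | v ∈ e}.ncard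

open Classical in
/-- The adjacency tensor of order `k`: the entry at `(i₁, i₂, …, i_k)` is `1 / (k-1)!` if
`{i₁, i₂, …, i_k}` is an edge and `0` otherwise. -/
def adjTensor (H : Hypergraph α) (k : ℕ) : Tensor k H.vertexSet := fun i y =>
  if insert (i : α) (Set.range fun j => (y j : α)) ∈ H.edgeSet then 1 / ((k - 1)! : ℂ) else 0

open Classical in
/-- The diagonal tensor of order `k` of the vertex degrees. -/
def degTensor (H : Hypergraph α) (k : ℕ) : Tensor k H.vertexSet := fun i y =>
  if ∀ j, y j = i then (H.degree i : ℂ) else 0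

/-- The Laplacian tensor `D - A`. -/
def laplacianTensor (H : Hypergraph α) (k : ℕ) : Tensor k H.vertexSet :=
  H.degTensor k - H.adjTensor k

/-- The signless Laplacian tensor `D + A`. -/
def signlessLaplacianTensor (H : Hypergraph α) (k : ℕ) : Tensor k H.vertexSet :=
  H.degTensor k + H.adjTensor k

end Hypergraph

end

/-!
A constant coefficient differential operator pairs with a polynomial through its symbol (the apolar
pairing), and pairing a monomial `∏ a_{uv}^{M(u,v)}` with `tr(A^N)` counts the closed walks that use
each arc of the multidigraph `M` once. So a trace is a weighted sum of numbers of Eulerian closed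
walks, which the BEST theorem expresses by determinants, and only multidigraphs with equal in- and
outdegrees contribute. The operators of row `i` supply either `k - 1` loops at `i` or the arcs from
`i` to the other vertices of an edge through `i`. An edge used at `i` has `k - 1` arcs leaving `i`,
while every other factor supplies at most one nonloop arc entering `i`, so for `t ≤ k` the only
multidigraphs that contribute consist of loops at a single vertex or, when `t = k`, are
the complete digraph on an edge.
-/

open MvPolynomial Finset

section ApolarPairing

variable {σ R : Type*} [CommSemiring R]

theorem prod_factorial_add_single [Fintype σ] (M : σ →₀ ℕ) (a : σ) :
    ∏ b, ((M + Finsupp.single a 1 : σ →₀ ℕ) b)! = (M a + 1) * ∏ b, (M b)! := by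
  classical
  have hb : ∀ b ∈ univ.erase a, ((M + Finsupp.single a 1 : σ →₀ ℕ) b)! = (M b)! := fun b hb ↦ by
    simp [(ne_of_mem_erase hb).symm]
  rw [← mul_prod_erase univ _ (mem_univ a), prod_congr rfl hb,
    ← mul_prod_erase univ (fun b ↦ (M b)!) (mem_univ a), ← mul_assoc]
  simp [Nat.factorial_succ]

variable [Fintype σ]

/-- The apolar (or Fischer) pairing `(p, q) ↦ (p(∂) q)(0)` of polynomials: distinct monomials are
orthogonal and `a^M` pairs with itself to `∏ (M a)!`. -/
noncomputable def apolarPairing : MvPolynomial σ R →ₗ[R] MvPolynomial σ R →ₗ[R] R :=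
  (basisMonomials σ R).constr R fun M ↦ (∏ a, ((M a)! : R)) • lcoeff R M

theorem apolarPairing_monomial (M : σ →₀ ℕ) (c : R) (q : MvPolynomial σ R) :
    apolarPairing (monomial M c) q = c * ((∏ a, ((M a)! : R)) * coeff M q) := by
  have h : monomial M c = c • basisMonomials σ R M := by simp [smul_monomial]
  rw [h, map_smul, apolarPairing, Module.Basis.constr_basis]
  simp

theorem apolarPairing_one (q : MvPolynomial σ R) : apolarPairing 1 q = constantCoeff q := by
  simpa [constantCoeff_eq] using apolarPairing_monomial 0 1 q

theorem apolarPairing_comm (p q : MvPolynomial σ R) :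
    apolarPairing p q = apolarPairing q p := by
  classical
  induction p using MvPolynomial.induction_on' with
  | monomial M c =>
    induction q using MvPolynomial.induction_on' with
    | monomial N d =>
      rw [apolarPairing_monomial, apolarPairing_monomial, coeff_monomial, coeff_monomial]
      by_cases h : M = N
      · subst h
        rw [if_pos rfl, if_pos rfl]
        ring
      · simp [h, Ne.symm h]
    | add q₁ q₂ h₁ h₂ => simp only [map_add, LinearMap.add_apply, h₁, h₂]
  | add p₁ p₂ h₁ h₂ => simp only [map_add, LinearMap.add_apply, h₁, h₂]

theorem apolarPairing_X_mul_left (a : σ) (p q : MvPolynomial σ R) :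
    apolarPairing (X a * p) q = apolarPairing p (pderiv a q) := by
  induction p using MvPolynomial.induction_on' with
  | monomial M c =>
    rw [X, monomial_mul, one_mul, apolarPairing_monomial, apolarPairing_monomial, add_comm,
      ← Nat.cast_prod, prod_factorial_add_single, coeff_pderiv]
    push_cast
    ring
  | add p₁ p₂ h₁ h₂ => simp only [mul_add, map_add, LinearMap.add_apply, h₁, h₂]

theorem apolarPairing_X_mul_right (a : σ) (p q : MvPolynomial σ R) :
    apolarPairing p (X a * q) = apolarPairing (pderiv a p) q := by
  rw [apolarPairing_comm, apolarPairing_X_mul_left, apolarPairing_comm]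

/-- The operator `f` is the constant coefficient differential operator `p(∂)`. This is encoded as
`f` being adjoint to the multiplication by `p`. -/
def IsSymbol (f : Module.End R (MvPolynomial σ R)) (p : MvPolynomial σ R) : Prop :=
  ∀ s q, apolarPairing (p * s) q = apolarPairing s (f q)

namespace IsSymbol

theorem pderiv (a : σ) : IsSymbol (R := R) (MvPolynomial.pderiv a).toLinearMap (X a) :=
  apolarPairing_X_mul_left a

theorem one : IsSymbol (1 : Module.End R (MvPolynomial σ R)) 1 := fun s q ↦ by simp

variable {f g : Module.End R (MvPolynomial σ R)} {p r : MvPolynomial σ R}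

theorem constantCoeff_apply (hf : IsSymbol f p) (q : MvPolynomial σ R) :
    constantCoeff (f q) = apolarPairing p q := by
  rw [← apolarPairing_one, ← hf, mul_one]

theorem mul (hf : IsSymbol f p) (hg : IsSymbol g r) : IsSymbol (f * g) (p * r) := fun s q ↦ by
  rw [mul_comm p, mul_assoc, hg, hf, Module.End.mul_apply]

theorem smul (c : R) (hf : IsSymbol f p) : IsSymbol (c • f) (c • p) := fun s q ↦ by
  simp only [smul_mul_assoc, map_smul, LinearMap.smul_apply, hf s q]

theorem pow (hf : IsSymbol f p) (n : ℕ) : IsSymbol (f ^ n) (p ^ n) := by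
  induction n with
  | zero => simpa using one
  | succ n ih => simpa only [pow_succ] using ih.mul hf

variable {ι : Type*} {F : ι → Module.End R (MvPolynomial σ R)} {P : ι → MvPolynomial σ R}

theorem sum (s : Finset ι) (h : ∀ i, IsSymbol (F i) (P i)) :
    IsSymbol (∑ i ∈ s, F i) (∑ i ∈ s, P i) := fun t q ↦ by
  simp only [sum_mul, map_sum, LinearMap.sum_apply, fun i ↦ h i t q]

theorem noncommProd (s : Finset ι) (comm : (s : Set ι).Pairwise (Function.onFun Commute F))
    (h : ∀ i, IsSymbol (F i) (P i)) : IsSymbol (s.noncommProd F comm) (∏ i ∈ s, P i) := by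
  classical
  induction s using Finset.induction_on with
  | empty => simpa using one
  | insert a s ha ih =>
    rw [noncommProd_insert_of_notMem _ _ _ _ ha, prod_insert ha]
    exact (h a).mul (ih _)

theorem prod_ofFn {n : ℕ} {F : Fin n → Module.End R (MvPolynomial σ R)}
    {P : Fin n → MvPolynomial σ R} (h : ∀ j, IsSymbol (F j) (P j)) :
    IsSymbol (List.ofFn F).prod (∏ j, P j) := by
  induction n with
  | zero => simpa using one
  | succ n ih =>
    rw [List.ofFn_succ, List.prod_cons, Fin.prod_univ_succ]
    exact (h 0).mul (ih fun j ↦ h j.succ)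

end IsSymbol

end ApolarPairing

/-- Multidigraphs with vertex set `V`, loops allowed: `M (u, v)` is the number of arcs from `u` to
`v`. A multidigraph is also the exponent of a monomial in the entries of a generic matrix. -/
abbrev Multidigraph (V : Type*) : Type _ := V × V →₀ ℕ

namespace Multidigraph

variable {V : Type*}

theorem exists_eq_add_single {M : Multidigraph V} {u j : V} (h : M (u, j) ≠ 0) :
    ∃ M' : Multidigraph V, M = M' + Finsupp.single (u, j) 1 :=
  ⟨M - Finsupp.single (u, j) 1,
    (tsub_add_cancel_of_le (Finsupp.single_le_iff.mpr (Nat.one_le_iff_ne_zero.mpr h))).symm⟩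

section Walks

variable [Fintype V]

/-- The number of arcs leaving `v`. -/
noncomputable def outdeg (v : V) : Multidigraph V →+ ℕ := ∑ j, Finsupp.applyAddHom (v, j)

/-- The number of arcs entering `v`. -/
noncomputable def indeg (v : V) : Multidigraph V →+ ℕ := ∑ i, Finsupp.applyAddHom (i, v)

theorem outdeg_apply (v : V) (M : Multidigraph V) : outdeg v M = ∑ j, M (v, j) := by
  simp [outdeg]

theorem indeg_apply (v : V) (M : Multidigraph V) : indeg v M = ∑ i, M (i, v) := by
  simp [indeg]

theorem apply_eq_zero_of_outdeg_eq_zero {M : Multidigraph V} {u : V} (h : outdeg u M = 0) (v : V) :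
    M (u, v) = 0 := by
  rw [outdeg_apply, sum_eq_zero_iff] at h
  exact h v (mem_univ v)

theorem apply_eq_zero_of_indeg_eq_zero {M : Multidigraph V} {v : V} (h : indeg v M = 0) (u : V) :
    M (u, v) = 0 := by
  rw [indeg_apply, sum_eq_zero_iff] at h
  exact h u (mem_univ u)

variable [DecidableEq V]

theorem outdeg_single (i j v : V) (c : ℕ) :
    outdeg v (Finsupp.single (i, j) c) = if v = i then c else 0 := by
  by_cases h : v = i <;> simp [outdeg_apply, Finsupp.single_apply, h]

theorem indeg_single (i j v : V) (c : ℕ) :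
    indeg v (Finsupp.single (i, j) c) = if v = j then c else 0 := by
  by_cases h : v = j <;> simp [indeg_apply, Finsupp.single_apply, h]

/-- The degree condition satisfied by the arcs of a walk from `u` to `r`. -/
def Balanced (M : Multidigraph V) (u r : V) : Prop :=
  ∀ v, outdeg v M + (if v = r then 1 else 0) = indeg v M + (if v = u then 1 else 0)

theorem balanced_self_iff {M : Multidigraph V} {r : V} :
    Balanced M r r ↔ ∀ v, outdeg v M = indeg v M :=
  forall_congr' fun _ ↦ Nat.add_right_cancel_iff

theorem balanced_add_single_iff {M : Multidigraph V} {u j r : V} :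
    Balanced (M + Finsupp.single (u, j) 1) u r ↔ Balanced M j r := by
  refine forall_congr' fun v ↦ ?_
  rw [map_add, map_add, outdeg_single, indeg_single]
  omega

variable {R : Type*} [CommRing R]

theorem apolarPairing_mvPolynomialX_pow_zero (M : Multidigraph V) (u r : V) :
    apolarPairing (monomial M (1 : R)) ((Matrix.mvPolynomialX V V R ^ 0) u r) =
      if M = 0 ∧ u = r then 1 else 0 := by
  by_cases hM : M = 0
  · by_cases hu : u = r <;> simp [apolarPairing_one, hM, hu]
  · by_cases hu : u = r <;> simp [apolarPairing_monomial, hM, hu, coeff_one, Ne.symm hM]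

theorem apolarPairing_mvPolynomialX_pow_succ (N : ℕ) (M : Multidigraph V) (u r : V) :
    apolarPairing (monomial M (1 : R)) ((Matrix.mvPolynomialX V V R ^ (N + 1)) u r) =
      ∑ j, (M (u, j) : R) * apolarPairing (monomial (M - Finsupp.single (u, j) 1) 1)
        ((Matrix.mvPolynomialX V V R ^ N) j r) := by
  rw [pow_succ', Matrix.mul_apply, map_sum]
  refine sum_congr rfl fun j _ ↦ ?_
  rw [Matrix.mvPolynomialX_apply, apolarPairing_X_mul_right, pderiv_monomial,
    apolarPairing_monomial, apolarPairing_monomial]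
  ring

theorem balanced_of_apolarPairing_ne_zero {N : ℕ} {M : Multidigraph V} {u r : V}
    (h : apolarPairing (monomial M (1 : R)) ((Matrix.mvPolynomialX V V R ^ N) u r) ≠ 0) :
    Balanced M u r := by
  induction N generalizing M u with
  | zero =>
    rw [apolarPairing_mvPolynomialX_pow_zero] at h
    obtain ⟨rfl, rfl⟩ := (ite_ne_right_iff.mp h).1
    simp [Balanced]
  | succ N ih =>
    rw [apolarPairing_mvPolynomialX_pow_succ] at h
    obtain ⟨j, -, hj⟩ := exists_ne_zero_of_sum_ne_zero h
    obtain ⟨M, rfl⟩ := exists_eq_add_single (M := M) (u := u) (j := j) fun h0 ↦ by simp [h0] at hj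
    rw [add_tsub_cancel_right] at hj
    exact balanced_add_single_iff.mpr (ih (right_ne_zero_of_mul hj))

/-- The number of closed walks of length `N`, with a base point, that use every arc of `M` exactly
once, parallel arcs being distinguished. -/
noncomputable def closedWalks (R : Type*) [CommRing R] (N : ℕ) (M : Multidigraph V) : R :=
  apolarPairing (monomial M 1) (Matrix.mvPolynomialX V V R ^ N).trace

theorem outdeg_eq_indeg_of_closedWalks_ne_zero {N : ℕ} {M : Multidigraph V}
    (h : closedWalks R N M ≠ 0) (v : V) : outdeg v M = indeg v M := by
  rw [closedWalks, Matrix.trace, map_sum] at h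
  obtain ⟨r, -, hr⟩ := exists_ne_zero_of_sum_ne_zero h
  exact balanced_self_iff.mp (balanced_of_apolarPairing_ne_zero hr) v

/-- The matrix whose determinant counts the walks with arcs `M` that end at `r`. Row `i ≠ r` is row
`i` of the Laplacian of `M` scaled by `(outdeg i M - 1)!`; if no arc leaves `i`, this is to be read
as the unit row, which is what the truncated subtraction gives. Row `r` is a scaled unit row. -/
noncomputable def eulerMatrix (R : Type*) [CommRing R] (M : Multidigraph V) (r : V) :
    Matrix V V R :=
  fun i ↦ ((outdeg i M)! : R) • Pi.single i 1 -
    if i = r then 0 else ((outdeg i M - 1)! : R) • fun j ↦ (M (i, j) : R)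

theorem eulerMatrix_root (M : Multidigraph V) (r : V) :
    eulerMatrix R M r r = ((outdeg r M)! : R) • Pi.single r 1 := by
  simp [eulerMatrix]

theorem eulerMatrix_of_ne (M : Multidigraph V) {i r : V} (h : i ≠ r) :
    eulerMatrix R M r i = ((outdeg i M)! : R) • Pi.single i 1 -
      ((outdeg i M - 1)! : R) • fun j ↦ (M (i, j) : R) := by
  simp [eulerMatrix, h]

theorem eulerMatrix_add_single_of_ne (M : Multidigraph V) {i u : V} (h : i ≠ u) (j r : V) :
    eulerMatrix R (M + Finsupp.single (u, j) 1) r i = eulerMatrix R M r i := by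
  have hu : ∀ l, (u, j) ≠ (i, l) := fun l hl ↦ h (congrArg Prod.fst hl).symm
  simp only [eulerMatrix, map_add, outdeg_single, if_neg h, add_zero,
    Finsupp.add_apply, Finsupp.single_eq_of_ne' (hu _)]

theorem sum_det_eulerMatrix_sub_single (M : Multidigraph V) (u r : V) :
    ∑ j, (M (u, j) : R) * (eulerMatrix R (M - Finsupp.single (u, j) 1) r).det =
      ((eulerMatrix R M r).updateRow u
        (∑ j, (M (u, j) : R) • eulerMatrix R (M - Finsupp.single (u, j) 1) r u)).det := by
  have hlin := (Matrix.detRowAlternating (R := R)).toMultilinearMap.map_update_sum (t := univ)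
    (i := u) (g := fun j ↦ (M (u, j) : R) • eulerMatrix R (M - Finsupp.single (u, j) 1) r u)
    (m := eulerMatrix R M r)
  refine Eq.trans (sum_congr rfl fun j _ ↦ ?_) hlin.symm
  change _ = ((eulerMatrix R M r).updateRow u _).det
  by_cases hj : M (u, j) = 0
  · rw [Matrix.det_updateRow_smul, hj, Nat.cast_zero, zero_mul, zero_mul]
  obtain ⟨M, rfl⟩ := exists_eq_add_single hj
  rw [Matrix.det_updateRow_smul, add_tsub_cancel_right]
  congr 2
  ext i : 1
  by_cases hi : i = u
  · subst hi
    rw [Matrix.updateRow_self]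
  · rw [Matrix.updateRow_ne hi, eulerMatrix_add_single_of_ne M hi]

theorem sum_smul_eulerMatrix_root (M : Multidigraph V) {r : V} (h : outdeg r M ≠ 0) :
    ∑ j, (M (r, j) : R) • eulerMatrix R (M - Finsupp.single (r, j) 1) r r =
      eulerMatrix R M r r := by
  have hrow : ∀ j, (M (r, j) : R) • eulerMatrix R (M - Finsupp.single (r, j) 1) r r =
      (M (r, j) : R) • ((outdeg r M - 1)! : R) • Pi.single r 1 := fun j ↦ by
    by_cases hj : M (r, j) = 0
    · simp [hj]
    obtain ⟨M, rfl⟩ := exists_eq_add_single hj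
    rw [add_tsub_cancel_right, eulerMatrix_root, map_add, outdeg_single, if_pos rfl,
      Nat.add_sub_cancel]
  rw [sum_congr rfl fun j _ ↦ hrow j, ← sum_smul, ← Nat.cast_sum, ← outdeg_apply, smul_smul,
    ← Nat.cast_mul, Nat.mul_factorial_pred h, eulerMatrix_root]

theorem sum_smul_eulerMatrix_of_ne (M : Multidigraph V) {u r : V} (hu : u ≠ r) :
    ∑ j, (M (u, j) : R) • eulerMatrix R (M - Finsupp.single (u, j) 1) r u =
      ((outdeg u M * (outdeg u M - 1)! : ℕ) : R) • Pi.single u 1 -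
        (((outdeg u M : R) - 1) * (outdeg u M - 1 - 1)!) • fun j ↦ (M (u, j) : R) := by
  have hrow : ∀ j, (M (u, j) : R) • eulerMatrix R (M - Finsupp.single (u, j) 1) r u =
      (M (u, j) : R) • (((outdeg u M - 1)! : R) • Pi.single u 1 - ((outdeg u M - 1 - 1)! : R) •
        ((fun l ↦ (M (u, l) : R)) - Pi.single j 1)) := fun j ↦ by
    by_cases hj : M (u, j) = 0
    · simp [hj]
    obtain ⟨M, rfl⟩ := exists_eq_add_single hj
    have hM : (fun l ↦ (((M + Finsupp.single (u, j) 1 : Multidigraph V) (u, l) : ℕ) : R)) -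
        Pi.single j 1 = fun l ↦ (M (u, l) : R) := by
      ext l
      by_cases hl : l = j <;> simp [hl, Finsupp.single_apply, eq_comm (a := j)]
    rw [hM, add_tsub_cancel_right, eulerMatrix_of_ne M hu, map_add, outdeg_single, if_pos rfl,
      Nat.add_sub_cancel]
  have hsingle : ∑ j, (M (u, j) : R) • (Pi.single j 1 : V → R) = fun l ↦ (M (u, l) : R) := by
    ext l
    simp [Pi.single_apply]
  have hout : ∑ j, (M (u, j) : R) = outdeg u M := by rw [outdeg_apply, Nat.cast_sum]
  simp only [hrow, smul_sub, sum_sub_distrib, smul_comm (M (u, _) : R), ← smul_sum, hsingle,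
    ← sum_smul, hout]
  push_cast
  module

theorem det_eulerMatrix_eq_zero {M : Multidigraph V} {r : V} (hM : ∀ v, outdeg v M = indeg v M)
    (h0 : M ≠ 0) (hr : outdeg r M = 0) : (eulerMatrix R M r).det = 0 := by
  -- The indicator function of the vertices with an outgoing arc is in the kernel.
  set x : V → R := fun j ↦ if outdeg j M = 0 then 0 else 1 with hx
  have hker : (eulerMatrix R M r).mulVec x = 0 := by
    have hcol : ∀ i j, (M (i, j) : R) * x j = M (i, j) := fun i j ↦ by
      by_cases hj : outdeg j M = 0
      · simp [apply_eq_zero_of_indeg_eq_zero ((hM j).symm.trans hj) i]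
      · simp [hx, hj]
    ext i
    by_cases hi : i = r
    · subst hi
      simp [Matrix.mulVec, eulerMatrix_root, hx, hr]
    · rw [Matrix.mulVec, eulerMatrix_of_ne M hi, sub_dotProduct, smul_dotProduct, smul_dotProduct,
        single_one_dotProduct, dotProduct]
      simp only [hcol, ← Nat.cast_sum, ← outdeg_apply, smul_eq_mul, Pi.zero_apply]
      by_cases ho : outdeg i M = 0
      · simp [hx, ho]
      · rw [← Nat.cast_mul, mul_comm (_ !), Nat.mul_factorial_pred ho]
        simp [hx, ho]
  obtain ⟨⟨i, j⟩, hij⟩ := Finsupp.ne_iff.mp h0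
  have hi : x i = 1 := if_neg fun h ↦ hij (apply_eq_zero_of_outdeg_eq_zero h j)
  have hdet : (eulerMatrix R M r).det • x = 0 := by
    rw [← Matrix.one_mulVec x, ← Matrix.smul_mulVec, ← Matrix.adjugate_mul, ← Matrix.mulVec_mulVec,
      hker, Matrix.mulVec_zero]
  simpa [hi] using congrFun hdet i

theorem det_updateRow_eulerMatrix_eq_zero {M : Multidigraph V} {u r : V} (hu : u ≠ r)
    (hin : indeg u M = 0) :
    ((eulerMatrix R M r).updateRow u fun j ↦ (M (u, j) : R)).det = 0 := by
  have hcol := apply_eq_zero_of_indeg_eq_zero hin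
  refine Matrix.det_eq_zero_of_column_eq_zero u fun i ↦ ?_
  by_cases hi : i = u
  · subst hi
    simp [hcol]
  rw [Matrix.updateRow_ne hi]
  by_cases hir : i = r
  · subst hir
    simp [eulerMatrix_root, hu]
  · simp [eulerMatrix_of_ne M hir, Ne.symm hi, hcol]

theorem sum_det_eulerMatrix_of_balanced {M : Multidigraph V} {u r : V} (hb : Balanced M u r)
    (h0 : M ≠ 0) :
    ∑ j, (M (u, j) : R) * (eulerMatrix R (M - Finsupp.single (u, j) 1) r).det =
      (eulerMatrix R M r).det := by
  by_cases hu : u = r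
  · subst hu
    by_cases ho : outdeg u M = 0
    · rw [det_eulerMatrix_eq_zero (balanced_self_iff.mp hb) h0 ho]
      simp [apply_eq_zero_of_outdeg_eq_zero ho]
    · rw [sum_det_eulerMatrix_sub_single, sum_smul_eulerMatrix_root M ho,
        Matrix.updateRow_eq_self]
  have hdeg : outdeg u M = indeg u M + 1 := by simpa [hu] using hb u
  rw [sum_det_eulerMatrix_sub_single, sum_smul_eulerMatrix_of_ne M hu,
    Nat.mul_factorial_pred (by omega)]
  by_cases hin : indeg u M = 0
  · have hrow : eulerMatrix R M r u + (fun j ↦ (M (u, j) : R)) =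
        ((outdeg u M)! : R) • Pi.single u 1 -
          (((outdeg u M : R) - 1) * (outdeg u M - 1 - 1)!) • fun j ↦ (M (u, j) : R) := by
      rw [eulerMatrix_of_ne M hu, hdeg, hin]
      simp
    rw [← hrow, Matrix.det_updateRow_add, Matrix.updateRow_eq_self,
      det_updateRow_eulerMatrix_eq_zero hu hin, add_zero]
  · have hfac : ((outdeg u M : R) - 1) * (outdeg u M - 1 - 1)! = (outdeg u M - 1)! := by
      rw [hdeg, Nat.add_sub_cancel, ← Nat.mul_factorial_pred hin]
      push_cast
      ring
    rw [hfac, ← eulerMatrix_of_ne M hu, Matrix.updateRow_eq_self]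

/-- The BEST theorem. The left-hand side is `∏ (M a)!` times the number of walks from `u` to `r`
with arcs `M`, that is, the number of such walks when parallel arcs are distinguished. -/
theorem apolarPairing_mvPolynomialX_pow {N : ℕ} {M : Multidigraph V} {u r : V}
    (hN : M.degree = N) (hb : Balanced M u r) :
    apolarPairing (monomial M (1 : R)) ((Matrix.mvPolynomialX V V R ^ N) u r) =
      (eulerMatrix R M r).det := by
  induction N generalizing M u with
  | zero =>
    obtain rfl : M = 0 := (Finsupp.degree_eq_zero_iff M).mp hN
    have hur : u = r := by
      by_contra h
      simpa [h] using hb u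
    have hone : eulerMatrix R 0 r = 1 := by
      ext i j
      by_cases hi : i = r <;> simp [eulerMatrix, hi, Matrix.one_apply, Pi.single_apply, eq_comm]
    rw [apolarPairing_mvPolynomialX_pow_zero, if_pos ⟨rfl, hur⟩, hone, Matrix.det_one]
  | succ N ih =>
    have h0 : M ≠ 0 := by
      rintro rfl
      simp at hN
    rw [apolarPairing_mvPolynomialX_pow_succ, ← sum_det_eulerMatrix_of_balanced hb h0]
    refine sum_congr rfl fun j _ ↦ ?_
    by_cases hj : M (u, j) = 0
    · simp [hj]
    obtain ⟨M, rfl⟩ := exists_eq_add_single hj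
    rw [add_tsub_cancel_right, ih (by simpa using hN) (balanced_add_single_iff.mp hb)]

theorem closedWalks_eq_sum_det {N : ℕ} {M : Multidigraph V} (hN : M.degree = N)
    (hM : ∀ v, outdeg v M = indeg v M) :
    closedWalks R N M = ∑ r, (eulerMatrix R M r).det := by
  rw [closedWalks, Matrix.trace, map_sum]
  exact sum_congr rfl fun r _ ↦ apolarPairing_mvPolynomialX_pow hN (balanced_self_iff.mpr hM)

end Walks

section Loops

variable [Fintype V]

/-- The multidigraph with `c i` loops at each vertex `i` and no other arcs. -/
noncomputable def loops (c : V → ℕ) : Multidigraph V := ∑ i, Finsupp.single (i, i) (c i)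

theorem degree_loops (c : V → ℕ) : (loops c).degree = ∑ i, c i := by
  simp [loops, map_sum]

variable [DecidableEq V]

theorem loops_apply (c : V → ℕ) (i j : V) : loops c (i, j) = if i = j then c i else 0 := by
  rw [loops, Finsupp.finsetSum_apply, sum_eq_single i]
  · simp [Finsupp.single_apply]
  · intro b _ hb
    simp [hb]
  · simp

omit [DecidableEq V] in
theorem outdeg_loops (c : V → ℕ) (v : V) : outdeg v (loops c) = c v := by
  classical
  simp [outdeg_apply, loops_apply]

omit [DecidableEq V] in
theorem indeg_loops (c : V → ℕ) (v : V) : indeg v (loops c) = c v := by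
  classical
  simp [indeg_apply, loops_apply]

theorem det_eulerMatrix_loops (R : Type*) [CommRing R] (c : V → ℕ) (r : V) :
    (eulerMatrix R (loops c) r).det = if ∀ i ≠ r, c i = 0 then ((c r)! : R) else 0 := by
  have hdiag : eulerMatrix R (loops c) r =
      Matrix.diagonal fun i ↦ if i = r then ((c r)! : R) else if c i = 0 then 1 else 0 := by
    ext i j
    by_cases hi : i = r
    · subst hi
      simp [eulerMatrix_root, outdeg_loops, Matrix.diagonal_apply, Pi.single_apply, eq_comm]
    · rw [eulerMatrix_of_ne _ hi]
      by_cases hc : c i = 0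
      · simp [outdeg_loops, loops_apply, hi, hc, Matrix.diagonal_apply, Pi.single_apply,
          eq_comm (a := j)]
      · by_cases hj : i = j
        · subst hj
          simp [outdeg_loops, loops_apply, hi, hc, ← Nat.mul_factorial_pred hc, mul_comm]
        · simp [loops_apply, hj, Ne.symm hj]
  rw [hdiag, Matrix.det_diagonal]
  split_ifs with h
  · rw [prod_eq_single r (fun i _ hi ↦ by simp [hi, h i hi]) (by simp), if_pos rfl]
  · push Not at h
    obtain ⟨i, hi, hc⟩ := h
    exact prod_eq_zero (mem_univ i) (by simp [hi, hc])

theorem closedWalks_loops (R : Type*) [CommRing R] (c : V → ℕ) :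
    closedWalks R (∑ i, c i) (loops c) =
      ∑ r, if ∀ i ≠ r, c i = 0 then ((c r)! : R) else 0 := by
  rw [closedWalks_eq_sum_det (degree_loops c) fun v ↦ by rw [outdeg_loops, indeg_loops]]
  exact sum_congr rfl fun r _ ↦ det_eulerMatrix_loops R c r

end Loops

variable [DecidableEq V]

/-- The arcs from `i` to the other vertices of `e`. -/
noncomputable def star (e : Finset V) (i : V) : Multidigraph V :=
  ∑ j ∈ e.erase i, Finsupp.single (i, j) 1

/-- The complete digraph on `e`. -/
noncomputable def complete (e : Finset V) : Multidigraph V := ∑ i ∈ e, star e i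

theorem degree_star {e : Finset V} {i : V} (hi : i ∈ e) : (star e i).degree = #e - 1 := by
  simp [star, map_sum, card_erase_of_mem hi]

theorem degree_complete (e : Finset V) : (complete e).degree = #e * (#e - 1) := by
  rw [complete, map_sum, sum_congr rfl fun i ↦ degree_star, sum_const, smul_eq_mul]

theorem complete_apply (e : Finset V) (i j : V) :
    complete e (i, j) = if i ∈ e ∧ j ∈ e.erase i then 1 else 0 := by
  have hstar : ∀ l, star e l (i, j) = if i = l then (if j ∈ e.erase i then 1 else 0) else 0 := by
    intro l
    rw [star, Finsupp.finsetSum_apply]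
    by_cases hl : i = l
    · subst hl
      simp [Finsupp.single_apply]
    · simp [hl]
  rw [complete, Finsupp.finsetSum_apply, sum_congr rfl fun l _ ↦ hstar l, sum_ite_eq, ite_and]

variable [Fintype V]

theorem outdeg_star {e : Finset V} {i : V} (hi : i ∈ e) (v : V) :
    outdeg v (star e i) = if v = i then #e - 1 else 0 := by
  simp only [star, map_sum, outdeg_single, sum_const, card_erase_of_mem hi, smul_eq_mul, mul_ite,
    mul_one, mul_zero]

theorem indeg_star (e : Finset V) (i v : V) :
    indeg v (star e i) = if v ∈ e.erase i then 1 else 0 := by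
  simp only [star, map_sum, indeg_single, sum_ite_eq]

theorem outdeg_complete (e : Finset V) (v : V) :
    outdeg v (complete e) = if v ∈ e then #e - 1 else 0 := by
  rw [complete, map_sum, sum_congr rfl fun i hi ↦ outdeg_star hi v, sum_ite_eq]

theorem indeg_complete (e : Finset V) (v : V) :
    indeg v (complete e) = if v ∈ e then #e - 1 else 0 := by
  have hfilter : {i ∈ e | v ∈ e.erase i} = if v ∈ e then e.erase v else ∅ := by
    ext i
    split_ifs with hv <;> simp [hv, and_comm, eq_comm]
  rw [complete, map_sum, sum_congr rfl fun i _ ↦ indeg_star e i v, sum_boole, hfilter, Nat.cast_id]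
  split_ifs with hv
  · exact card_erase_of_mem hv
  · rfl

variable {K : Type*} [Field K] [CharZero K]

theorem eulerMatrix_complete {e : Finset V} (he : 2 ≤ #e) {r : V} (hr : r ∈ e) :
    eulerMatrix K (complete e) r =
      Matrix.diagonal (fun i ↦ if i = r then ((#e - 1)! : K) else
        if i ∈ e then #e * (#e - 2)! else 1) *
      (1 + Matrix.replicateCol Unit (fun i ↦ if i ∈ e.erase r then -(#e : K)⁻¹ else 0) *
        Matrix.replicateRow Unit fun j ↦ if j ∈ e then (1 : K) else 0) := by
  have hk : (#e : K) ≠ 0 := Nat.cast_ne_zero.mpr (by omega)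
  have hfac : ((#e - 1)! : K) = #e * (#e - 2)! * (1 + -(#e : K)⁻¹) := by
    rw [← Nat.mul_factorial_pred (by omega : #e - 1 ≠ 0), Nat.cast_mul,
      Nat.cast_pred (by omega), Nat.sub_sub]
    field_simp
    ring
  ext i j
  rw [Matrix.diagonal_mul, Matrix.add_apply, Matrix.one_apply, Matrix.mul_apply]
  by_cases hi : i = r
  · subst hi
    simp [eulerMatrix_root, outdeg_complete, hr, Pi.single_apply, eq_comm]
  rw [eulerMatrix_of_ne _ hi, outdeg_complete]
  by_cases hie : i ∈ e
  · by_cases hj : i = j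
    · subst hj
      simp [complete_apply, hi, hie, hfac]
    · by_cases hje : j ∈ e <;>
        simp [complete_apply, hi, hie, hj, Ne.symm hj, hje, hk, Nat.sub_sub, mul_right_comm]
  · simp [complete_apply, hi, hie, Pi.single_apply, eq_comm]

theorem det_eulerMatrix_complete {e : Finset V} (he : 2 ≤ #e) {r : V} (hr : r ∈ e) :
    (eulerMatrix K (complete e) r).det =
      (#e - 1)! * ((#e : K) * (#e - 2)!) ^ (#e - 1) * (#e : K)⁻¹ := by
  have hk : (#e : K) ≠ 0 := Nat.cast_ne_zero.mpr (by omega)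
  have hdiag : ∏ i, (if i = r then ((#e - 1)! : K) else if i ∈ e then #e * (#e - 2)! else 1) =
      (#e - 1)! * ((#e : K) * (#e - 2)!) ^ (#e - 1) := by
    rw [← card_erase_of_mem hr, ← mul_prod_erase univ _ (mem_univ r), if_pos rfl, ← prod_const]
    congr 1
    rw [← prod_subset (erase_subset_erase r (subset_univ e)) fun i hi hie ↦ by simp_all]
    exact prod_congr rfl fun i hi ↦ by simp_all
  have hdot : (fun j ↦ if j ∈ e then (1 : K) else 0) ⬝ᵥ
      (fun i ↦ if i ∈ e.erase r then -(#e : K)⁻¹ else 0) = -((#e - 1 : ℕ) * (#e : K)⁻¹) := by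
    simp only [dotProduct, mul_ite, mul_zero, sum_ite_mem, univ_inter]
    rw [sum_congr rfl fun i hi ↦ by rw [if_pos (mem_of_mem_erase hi)], sum_const,
      card_erase_of_mem hr, nsmul_eq_mul, one_mul, mul_neg]
  rw [eulerMatrix_complete he hr, Matrix.det_mul, Matrix.det_diagonal, hdiag,
    Matrix.det_one_add_replicateCol_mul_replicateRow, hdot, Nat.cast_pred (by omega)]
  congr 1
  field_simp
  ring

theorem closedWalks_complete {e : Finset V} (he : 2 ≤ #e) :
    closedWalks K (#e * (#e - 1)) (complete e) =
      (#e - 1)! * ((#e : K) * (#e - 2)!) ^ (#e - 1) := by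
  have hbal : ∀ v, outdeg v (complete e) = indeg v (complete e) := fun v ↦ by
    rw [outdeg_complete, indeg_complete]
  have hne : complete e ≠ 0 := fun h ↦ by
    have hdeg := degree_complete e
    rw [h, map_zero, zero_eq_mul] at hdeg
    omega
  rw [closedWalks_eq_sum_det (degree_complete e) hbal,
    ← sum_subset (subset_univ e) fun r _ hr ↦ det_eulerMatrix_eq_zero hbal hne (by
      rw [outdeg_complete, if_neg hr]),
    sum_congr rfl fun r ↦ det_eulerMatrix_complete he, sum_const, nsmul_eq_mul, mul_comm,
    inv_mul_cancel_right₀ (Nat.cast_ne_zero.mpr (by omega))]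

end Multidigraph

section FiniteSums

variable {V R : Type*} [CommSemiring R]

theorem sum_prod_comp_of_image_eq [Fintype V] [DecidableEq V] {m : ℕ} {s : Finset V} (hs : #s = m)
    (g : V → R) : ∑ y : Fin m → V with univ.image y = s, ∏ j, g (y j) = m ! * ∏ x ∈ s, g x := by
  have hsum : ∑ w : Fin m ≃ s, ∏ j, g (w j) =
      ∑ y : Fin m → V with univ.image y = s, ∏ j, g (y j) := by
    refine sum_nbij (fun w j ↦ (w j : V)) (fun w _ ↦ ?_) (fun w _ w' _ h ↦ ?_) (fun y hy ↦ ?_)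
      fun w _ ↦ rfl
    · rw [mem_filter_univ]
      ext v
      simp only [mem_image, mem_univ, true_and]
      exact ⟨fun ⟨j, hj⟩ ↦ hj ▸ (w j).2, fun hv ↦ ⟨w.symm ⟨v, hv⟩, by simp⟩⟩
    · exact Equiv.ext fun j ↦ Subtype.ext (congrFun h j)
    · obtain rfl := (mem_filter_univ y).mp hy
      have hinj : Function.Injective y := by
        rw [← Set.injOn_univ, ← coe_univ, ← card_image_iff, hs, card_fin]
      refine ⟨(Equiv.ofInjective y hinj).trans (Equiv.setCongr (by simp)), mem_univ _, rfl⟩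
  have hprod : ∀ w : Fin m ≃ s, ∏ j, g (w j) = ∏ x ∈ s, g x := fun w ↦ by
    rw [w.prod_comp fun x ↦ g x, prod_coe_sort]
  rw [← hsum, sum_congr rfl fun w _ ↦ hprod w, sum_const, card_univ,
    Fintype.card_equiv (Fintype.equivOfCardEq (by simp [hs])), Fintype.card_fin, nsmul_eq_mul]

theorem prod_sum_pow {ι γ : Type*} [Fintype ι] [DecidableEq ι] [Fintype γ] (F : ι → γ → R)
    (m : ι → ℕ) :
    ∏ i, (∑ c, F i c) ^ m i = ∑ f : (Σ i, Fin (m i)) → γ, ∏ s, F s.1 (f s) := by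
  rw [← Fintype.prod_sum, Fintype.prod_sigma]
  exact prod_congr rfl fun i _ ↦ by simp

end FiniteSums

namespace Tensor

open Multidigraph

variable {k : ℕ} {V : Type*}

section Symbol

variable [Fintype V]

/-- The symbol `∑_y t_{iy} a_{i i₂} ⋯ a_{i i_k}` of the differential operator `rowOp T i`. -/
noncomputable def rowPoly (T : Tensor k V) (i : V) : MvPolynomial (V × V) ℂ :=
  ∑ y : Fin (k - 1) → V, T i y • ∏ j, X (i, y j)

theorem isSymbol_traceOp (T : Tensor k V) (m : V → ℕ) :
    IsSymbol (traceOp T m) (∏ i, (1 / ((m i * (k - 1))! : ℂ)) • rowPoly T i ^ m i) :=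
  IsSymbol.noncommProd _ _ fun _ ↦ .smul _ <| .pow
    (.sum _ fun _ ↦ .smul _ <| .prod_ofFn fun _ ↦ .pderiv _) _

theorem trace_eq_sum_apolarPairing [DecidableEq V] (d : ℕ) (T : Tensor k V) :
    trace d T = ((k : ℂ) - 1) ^ ((Fintype.card V : ℤ) - 1) *
      ∑ m ∈ piAntidiag (univ : Finset V) d, (∏ i, (1 / ((m i * (k - 1))! : ℂ))) *
        apolarPairing (∏ i, rowPoly T i ^ m i)
          (Matrix.mvPolynomialX V V ℂ ^ (d * (k - 1))).trace := by
  rw [trace, map_sum]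
  congr 1
  refine sum_congr rfl fun m _ ↦ ?_
  rw [(isSymbol_traceOp T m).constantCoeff_apply, Finset.prod_smul, map_smul,
    LinearMap.smul_apply, smul_eq_mul]

theorem rowPoly_add (T T' : Tensor k V) (i : V) :
    rowPoly (T + T' : Tensor k V) i = rowPoly T i + rowPoly T' i := by
  simp only [rowPoly, Pi.add_apply, add_smul, sum_add_distrib]

end Symbol

variable [DecidableEq V]

/-- The diagonal tensor of order `k` with diagonal entries `d`. -/
def diagonal (k : ℕ) (d : V → ℂ) : Tensor k V := fun i y ↦ if ∀ j, y j = i then d i else 0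

/-- The adjacency tensor of order `k` of the hypergraph with edge weights `w`: its entry at
`(i₁, …, i_k)` is `w {i₁, …, i_k} / (k - 1)!`. -/
noncomputable def ofWeight (k : ℕ) (w : Finset V → ℂ) : Tensor k V :=
  fun i y ↦ w (insert i (univ.image y)) / (k - 1)!

/-- The arcs of the monomials of row `i` of the symbol of `diagonal k d + ofWeight k w`: the choice
`none` is the diagonal monomial, the choice `some e` is the monomial of the edge `e`. -/
noncomputable def termArcs (k : ℕ) (i : V) : Option (Finset V) → Multidigraph V
  | none => Finsupp.single (i, i) (k - 1)
  | some e => star e i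

/-- The coefficient of the monomial `termArcs k i c` in the symbol of
`diagonal k d + ofWeight k w`. -/
def termCoeff (d : V → ℂ) (w : Finset V → ℂ) (i : V) : Option (Finset V) → ℂ
  | none => d i
  | some e => if i ∈ e then w e else 0

theorem mem_and_card_eq_of_termCoeff_ne_zero {d : V → ℂ} {w : Finset V → ℂ}
    (hw : ∀ e, w e ≠ 0 → #e = k) {i : V} {c : Option (Finset V)} (hc : termCoeff d w i c ≠ 0) :
    ∀ e ∈ c, i ∈ e ∧ #e = k := by
  rintro e rfl
  have he := ite_ne_right_iff.mp hc
  exact ⟨he.1, hw e he.2⟩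

variable [Fintype V]

theorem rowPoly_diagonal (d : V → ℂ) (i : V) :
    rowPoly (diagonal k d) i = monomial (Finsupp.single (i, i) (k - 1)) (d i) := by
  rw [rowPoly, sum_eq_single (fun _ ↦ i)]
  · simp [diagonal, X_pow_eq_monomial, smul_monomial]
  · intro y _ hy
    rw [diagonal, if_neg fun h ↦ hy (funext h), zero_smul]
  · simp

theorem sum_prod_X_of_insert_image_eq {e : Finset V} (he : #e = k) {i : V} (hi : i ∈ e) :
    ∑ y : Fin (k - 1) → V with insert i (univ.image y) = e,
      ∏ j, (X (i, y j) : MvPolynomial (V × V) ℂ) = monomial (star e i) ↑((k - 1)!) := by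
  have hcard : #(e.erase i) = k - 1 := by rw [card_erase_of_mem hi, he]
  have hiff : ∀ y : Fin (k - 1) → V,
      insert i (univ.image y) = e ↔ univ.image y = e.erase i := fun y ↦ by
    refine ⟨fun h ↦ (eq_of_subset_of_card_le (subset_insert_iff.mp h.ge) ?_).symm, fun h ↦ ?_⟩
    · rw [hcard]
      exact card_image_le.trans (card_fin _).le
    · rw [h, insert_erase hi]
  simp only [hiff]
  rw [sum_prod_comp_of_image_eq hcard fun v ↦ (X (i, v) : MvPolynomial (V × V) ℂ),
    Multidigraph.star, monomial_sum_index, ← map_natCast C]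
  rfl

theorem rowPoly_ofWeight {w : Finset V → ℂ} (hw : ∀ e, w e ≠ 0 → #e = k) (i : V) :
    rowPoly (ofWeight k w) i =
      ∑ e, monomial (star e i) (if i ∈ e then w e else 0) := by
  rw [rowPoly, ← sum_fiberwise univ fun y : Fin (k - 1) → V ↦ insert i (univ.image y)]
  refine sum_congr rfl fun e _ ↦ ?_
  have hterm : ∀ y ∈ ({y | insert i (univ.image y) = e} : Finset (Fin (k - 1) → V)),
      ofWeight k w i y • ∏ j, (X (i, y j) : MvPolynomial (V × V) ℂ) =
        (w e / (k - 1)!) • ∏ j, X (i, y j) := fun y hy ↦ by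
    rw [ofWeight, (mem_filter_univ y).mp hy]
  rw [sum_congr rfl hterm, ← smul_sum]
  by_cases hwe : w e = 0
  · simp [hwe]
  split_ifs with hi
  · rw [sum_prod_X_of_insert_image_eq (hw e hwe) hi, smul_monomial, smul_eq_mul,
      div_mul_cancel₀ _ (Nat.cast_ne_zero.mpr (Nat.factorial_ne_zero _))]
  · have hempty : ({y | insert i (univ.image y) = e} : Finset (Fin (k - 1) → V)) = ∅ :=
      filter_eq_empty_iff.mpr fun y _ hy ↦ hi (hy ▸ mem_insert_self _ _)
    rw [hempty, sum_empty, smul_zero, map_zero]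

theorem rowPoly_diagonal_add_ofWeight (d : V → ℂ) {w : Finset V → ℂ}
    (hw : ∀ e, w e ≠ 0 → #e = k) (i : V) :
    rowPoly (diagonal k d + ofWeight k w : Tensor k V) i =
      ∑ c, monomial (termArcs k i c) (termCoeff d w i c) := by
  rw [rowPoly_add, rowPoly_diagonal, rowPoly_ofWeight hw, Fintype.sum_option]
  rfl

theorem prod_rowPoly_pow (d : V → ℂ) {w : Finset V → ℂ} (hw : ∀ e, w e ≠ 0 → #e = k)
    (m : V → ℕ) :
    ∏ i, rowPoly (diagonal k d + ofWeight k w : Tensor k V) i ^ m i =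
      ∑ f : (Σ i, Fin (m i)) → Option (Finset V),
        monomial (∑ s, termArcs k s.1 (f s)) (∏ s, termCoeff d w s.1 (f s)) := by
  simp only [rowPoly_diagonal_add_ofWeight d hw, prod_sum_pow, monomial_sum_prod]

section Balance

variable {S : Type*} [Fintype S] {root : S → V} {f : S → Option (Finset V)}

theorem outdeg_termArcs_add (hk : 1 ≤ k) {i : V} {c : Option (Finset V)}
    (hc : ∀ e ∈ c, i ∈ e ∧ #e = k) (v : V) :
    outdeg v (termArcs k i c) + (if v ∈ c.getD ∅ then 1 else 0) =
      indeg v (termArcs k i c) + k * (if c ≠ none ∧ i = v then 1 else 0) := by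
  cases c with
  | none => simp [termArcs, outdeg_single, indeg_single, -Finsupp.single_tsub]
  | some e =>
    obtain ⟨hi, rfl⟩ := hc e rfl
    rw [termArcs, outdeg_star hi, indeg_star]
    by_cases hv : v = i
    · subst hv
      simp [hi, Nat.sub_add_cancel hk]
    · simp [hv, Ne.symm hv]

theorem mul_card_root_eq (hk : 1 ≤ k) (hf : ∀ s, ∀ e ∈ f s, root s ∈ e ∧ #e = k) (v : V)
    (hv : outdeg v (∑ s, termArcs k (root s) (f s)) =
      indeg v (∑ s, termArcs k (root s) (f s))) :
    k * #{s | f s ≠ none ∧ root s = v} = #{s | v ∈ (f s).getD ∅} := by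
  have hsum := sum_congr (s₁ := univ) rfl fun s _ ↦ outdeg_termArcs_add hk (hf s) v
  rw [sum_add_distrib, sum_add_distrib, ← map_sum, ← map_sum, hv, ← mul_sum] at hsum
  simpa using (Nat.add_left_cancel hsum).symm

/-- An edge used at a root has `k - 1` arcs leaving it and any other summand has at most one nonloop
arc entering it, so with at most `k` summands all the others must come from edges through it. -/
theorem card_root_eq_one_and_forall_mem (hk : 1 ≤ k) (hS : Fintype.card S ≤ k)
    (hf : ∀ s, ∀ e ∈ f s, root s ∈ e ∧ #e = k)
    (hbal : ∀ v, outdeg v (∑ s, termArcs k (root s) (f s)) =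
      indeg v (∑ s, termArcs k (root s) (f s))) {s : S} (hs : f s ≠ none) :
    #{s' | f s' ≠ none ∧ root s' = root s} = 1 ∧ ∀ s', root s ∈ (f s').getD ∅ := by
  have heq := mul_card_root_eq hk hf (root s) (hbal _)
  have hle : #{s' | root s ∈ (f s').getD ∅} ≤ Fintype.card S := card_filter_le _ _
  have hpos : 0 < #{s' | f s' ≠ none ∧ root s' = root s} := card_pos.mpr ⟨s, by simp [hs]⟩
  have hone : #{s' | f s' ≠ none ∧ root s' = root s} = 1 := by nlinarith
  have huniv : #{s' | root s ∈ (f s').getD ∅} = #(univ : Finset S) := by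
    rw [card_univ]
    rw [hone] at heq
    omega
  exact ⟨hone, fun s' ↦ card_filter_eq_iff.mp huniv s' (mem_univ s')⟩

/-- If some summand comes from an edge, every summand does, the roots are distinct, and together
they form each of the edges. -/
theorem exists_eq_const_of_balanced (hk : 1 ≤ k) (hS : Fintype.card S ≤ k)
    (hf : ∀ s, ∀ e ∈ f s, root s ∈ e ∧ #e = k)
    (hbal : ∀ v, outdeg v (∑ s, termArcs k (root s) (f s)) =
      indeg v (∑ s, termArcs k (root s) (f s))) : ∃ c, ∀ s, f s = c := by
  by_cases hnone : ∀ s, f s = none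
  · exact ⟨none, hnone⟩
  push Not at hnone
  obtain ⟨s₀, hs₀⟩ := hnone
  have hcount : ∀ s, f s ≠ none →
      #{s' | f s' ≠ none ∧ root s' = root s} = 1 ∧ ∀ s', root s ∈ (f s').getD ∅ :=
    fun s ↦ card_root_eq_one_and_forall_mem hk hS hf hbal
  have hcard : k ≤ Fintype.card S := by
    have heq := mul_card_root_eq hk hf (root s₀) (hbal _)
    rw [(hcount s₀ hs₀).1, mul_one] at heq
    exact heq.trans_le (card_filter_le _ _)
  have hsome : ∀ s, f s ≠ none := fun s hs ↦ by
    simpa [hs] using (hcount s₀ hs₀).2 s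
  have hinj : Function.Injective root := fun s s' h ↦
    card_le_one.mp (hcount s' (hsome s')).1.le s (by simp [hsome, h]) s' (by simp [hsome])
  refine ⟨some (univ.image root), fun s ↦ ?_⟩
  obtain ⟨e, he⟩ := Option.ne_none_iff_exists'.mp (hsome s)
  have hsub : univ.image root ⊆ e := image_subset_iff.mpr fun s' _ ↦ by
    simpa [he] using (hcount s' (hsome s')).2 s
  rw [he, eq_of_subset_of_card_le hsub]
  rw [card_image_of_injective _ hinj, (hf s e he).2, card_univ]
  exact hcard

end Balance

theorem apolarPairing_prod_rowPoly_pow (hk : 1 ≤ k) (d : V → ℂ) {w : Finset V → ℂ}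
    (hw : ∀ e, w e ≠ 0 → #e = k) {m : V → ℕ} (hm₀ : ∑ i, m i ≠ 0) (hm : ∑ i, m i ≤ k) (N : ℕ) :
    apolarPairing (∏ i, rowPoly (diagonal k d + ofWeight k w : Tensor k V) i ^ m i)
        (Matrix.mvPolynomialX V V ℂ ^ N).trace =
      ∑ c, (∏ i, termCoeff d w i c ^ m i) * closedWalks ℂ N (∑ i, m i • termArcs k i c) := by
  have hS : Fintype.card (Σ i, Fin (m i)) = ∑ i, m i := by simp
  have : Nonempty (Σ i, Fin (m i)) := Fintype.card_pos_iff.mp (by omega)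
  have hmonomial : ∀ (M : Multidigraph V) (a : ℂ),
      apolarPairing (monomial M a) (Matrix.mvPolynomialX V V ℂ ^ N).trace =
        a * closedWalks ℂ N M := fun M a ↦ by
    rw [closedWalks, apolarPairing_monomial, apolarPairing_monomial, one_mul]
  simp only [prod_rowPoly_pow d hw, map_sum, LinearMap.sum_apply, hmonomial]
  symm
  refine Fintype.sum_of_injective (Function.const _) Function.const_injective _ _
    (fun f hf ↦ ?_) fun c ↦ ?_
  · by_contra hne
    obtain ⟨hcoeff, hwalk⟩ := mul_ne_zero_iff.mp hne
    obtain ⟨c, hc⟩ := exists_eq_const_of_balanced hk (hS.trans_le hm)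
      (fun s ↦ mem_and_card_eq_of_termCoeff_ne_zero hw (prod_ne_zero_iff.mp hcoeff s (mem_univ s)))
      (outdeg_eq_indeg_of_closedWalks_ne_zero hwalk)
    exact hf ⟨c, funext fun s ↦ (hc s).symm⟩
  · simp [Fintype.prod_sigma, Fintype.sum_sigma]

theorem sum_prod_pow_mul_closedWalks_loops (hk : 2 ≤ k) (d : V → ℂ) (t : ℕ) :
    ∑ m ∈ piAntidiag (univ : Finset V) t, (∏ i, (1 / ((m i * (k - 1))! : ℂ))) *
      ((∏ i, d i ^ m i) * closedWalks ℂ (t * (k - 1)) (loops fun i ↦ m i * (k - 1))) =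
      ∑ v, d v ^ t := by
  have hwalks : ∀ m ∈ piAntidiag (univ : Finset V) t,
      closedWalks ℂ (t * (k - 1)) (loops fun i ↦ m i * (k - 1)) =
        ∑ r, if ∀ i ≠ r, m i = 0 then ((m r * (k - 1))! : ℂ) else 0 := fun m hm ↦ by
    have hk' : k - 1 ≠ 0 := by omega
    rw [← (mem_piAntidiag.mp hm).1, sum_mul, closedWalks_loops]
    simp [hk']
  rw [sum_congr rfl fun m hm ↦ by rw [hwalks m hm, mul_sum, mul_sum], sum_comm]
  refine sum_congr rfl fun r _ ↦ ?_
  rw [sum_eq_single (Pi.single r t)]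
  · have hfac : ∏ i, (1 / (((Pi.single r t : V → ℕ) i * (k - 1))! : ℂ)) =
        1 / ((t * (k - 1))! : ℂ) := by
      rw [Fintype.prod_eq_single r fun i hi ↦ by simp [hi], Pi.single_eq_same]
    have hpow : ∏ i, d i ^ (Pi.single r t : V → ℕ) i = d r ^ t := by
      rw [Fintype.prod_eq_single r fun i hi ↦ by simp [hi], Pi.single_eq_same]
    have hne : ((t * (k - 1))! : ℂ) ≠ 0 := Nat.cast_ne_zero.mpr (Nat.factorial_ne_zero _)
    rw [hfac, hpow, if_pos fun i hi ↦ by simp [hi], Pi.single_eq_same]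
    field_simp
  · intro m hm hne
    rw [if_neg, mul_zero, mul_zero]
    intro h
    have hmr : m r = t := by
      rw [← (mem_piAntidiag.mp hm).1, Fintype.sum_eq_single r h]
    refine hne (funext fun i ↦ ?_)
    by_cases hi : i = r
    · subst hi
      simp [hmr]
    · simp [hi, h]
  · simp

theorem eq_and_eq_indicator_of_closedWalks_ne_zero (hk : 1 ≤ k) {e : Finset V} (he : #e = k)
    {t N : ℕ} (ht₀ : t ≠ 0) (ht : t ≤ k) {m : V → ℕ} (hm : ∑ i, m i = t)
    (hme : ∀ i, m i ≠ 0 → i ∈ e) (hwalk : closedWalks ℂ N (∑ i, m i • star e i) ≠ 0) :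
    t = k ∧ m = fun i ↦ if i ∈ e then 1 else 0 := by
  have hmul : ∀ v ∈ e, k * m v = t := fun v hv ↦ by
    have hcount := mul_card_root_eq (S := Σ i, Fin (m i)) (root := Sigma.fst)
      (f := fun _ ↦ some e) hk
      (fun s e' he' ↦ Option.some_inj.mp he' ▸ ⟨hme s.1 (Nat.ne_zero_of_lt s.2.2), he⟩) v
      (by simpa [Fintype.sum_sigma, termArcs] using
        outdeg_eq_indeg_of_closedWalks_ne_zero hwalk v)
    have hroot : #{s : Σ i, Fin (m i) | some e ≠ none ∧ s.1 = v} = m v := by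
      rw [card_filter, Fintype.sum_sigma]
      simp
    rw [hroot] at hcount
    simpa [hv, hm] using hcount
  obtain ⟨v, hv⟩ : e.Nonempty := card_pos.mp (by omega)
  obtain rfl : t = k := ht.antisymm (Nat.le_of_dvd (by omega) ⟨m v, (hmul v hv).symm⟩)
  refine ⟨rfl, funext fun i ↦ ?_⟩
  split_ifs with hi
  · exact Nat.eq_of_mul_eq_mul_left (by omega) ((hmul i hi).trans (mul_one t).symm)
  · by_contra h
    exact hi (hme i h)

theorem pow_mul_closedWalks_complete {e : Finset V} (he : 2 ≤ #e) :
    (1 / ((#e - 1)! : ℂ)) ^ #e * closedWalks ℂ (#e * (#e - 1)) (complete e) =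
      (#e : ℂ) ^ (#e - 1) * ((#e : ℂ) - 1) ^ (1 - (#e : ℤ)) := by
  have hfac : ((#e - 1)! : ℂ) = (#e - 1) * (#e - 2)! := by
    rw [← Nat.mul_factorial_pred (by omega : #e - 1 ≠ 0), Nat.cast_mul, Nat.cast_pred (by omega),
      Nat.sub_sub]
  have hne : ((#e - 1)! : ℂ) ≠ 0 := Nat.cast_ne_zero.mpr (Nat.factorial_ne_zero _)
  have hne₂ : ((#e - 2)! : ℂ) ≠ 0 := Nat.cast_ne_zero.mpr (Nat.factorial_ne_zero _)
  have hexp : 1 - (#e : ℤ) = -((#e - 1 : ℕ) : ℤ) := by omega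
  calc (1 / ((#e - 1)! : ℂ)) ^ #e * closedWalks ℂ (#e * (#e - 1)) (complete e)
      = (1 / ((#e - 1)! : ℂ)) ^ (#e - 1 + 1) *
          ((#e - 1)! * ((#e : ℂ) * (#e - 2)!) ^ (#e - 1)) := by
        rw [closedWalks_complete he, Nat.sub_add_cancel (by omega)]
    _ = ((#e : ℂ) * (#e - 2)! / (#e - 1)!) ^ (#e - 1) := by
        rw [pow_succ, div_pow, div_pow, one_pow]
        field_simp
    _ = ((#e : ℂ) / (#e - 1)) ^ (#e - 1) := by
        rw [hfac, mul_div_mul_right _ _ hne₂]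
    _ = (#e : ℂ) ^ (#e - 1) * ((#e : ℂ) - 1) ^ (1 - (#e : ℤ)) := by
        rw [hexp, zpow_neg, zpow_natCast, div_pow, div_eq_mul_inv]

theorem prod_pow_mul_closedWalks_indicator {e : Finset V} (he : 2 ≤ #e) (a : ℂ) :
    (∏ i, (1 / (((if i ∈ e then 1 else 0) * (#e - 1))! : ℂ))) *
      ((∏ i, (if i ∈ e then a else 0) ^ (if i ∈ e then 1 else 0)) *
        closedWalks ℂ (#e * (#e - 1)) (∑ i, (if i ∈ e then 1 else 0) • star e i)) =
      a ^ #e * ((#e : ℂ) ^ (#e - 1) * ((#e : ℂ) - 1) ^ (1 - (#e : ℤ))) := by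
  have hfac : ∏ i, (1 / (((if i ∈ e then 1 else 0) * (#e - 1))! : ℂ)) =
      (1 / ((#e - 1)! : ℂ)) ^ #e := by
    rw [← prod_const, ← prod_subset (subset_univ e) fun i _ hi ↦ by simp [hi]]
    exact prod_congr rfl fun i hi ↦ by simp [hi]
  have hcoeff : ∏ i, (if i ∈ e then a else 0) ^ (if i ∈ e then 1 else 0) = a ^ #e := by
    rw [← prod_const, ← prod_subset (subset_univ e) fun i _ hi ↦ by simp [hi]]
    exact prod_congr rfl fun i hi ↦ by simp [hi]
  have harcs : ∑ i, (if i ∈ e then 1 else 0) • star e i = complete e := by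
    simp [complete, ite_smul]
  rw [hfac, hcoeff, harcs, mul_left_comm, pow_mul_closedWalks_complete he]

theorem sum_prod_pow_mul_closedWalks_star (hk : 2 ≤ k) {w : Finset V → ℂ}
    (hw : ∀ e, w e ≠ 0 → #e = k) (e : Finset V) {t : ℕ} (ht₀ : t ≠ 0) (ht : t ≤ k) :
    ∑ m ∈ piAntidiag (univ : Finset V) t, (∏ i, (1 / ((m i * (k - 1))! : ℂ))) *
      ((∏ i, (if i ∈ e then w e else 0) ^ m i) *
        closedWalks ℂ (t * (k - 1)) (∑ i, m i • star e i)) =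
      if t = k then w e ^ k * ((k : ℂ) ^ (k - 1) * ((k : ℂ) - 1) ^ (1 - (k : ℤ))) else 0 := by
  by_cases hwe : w e = 0
  · have hterm : ∀ m ∈ piAntidiag (univ : Finset V) t,
        ∏ i, (if i ∈ e then w e else 0) ^ m i = 0 := fun m hm ↦ by
      rw [hwe]
      simp only [ite_self, prod_pow_eq_pow_sum, (mem_piAntidiag.mp hm).1, zero_pow ht₀]
    rw [sum_eq_zero fun m hm ↦ by rw [hterm m hm, zero_mul, mul_zero]]
    rw [hwe, zero_pow (by omega), zero_mul, ite_self]
  obtain rfl : #e = k := hw e hwe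
  have hunique : ∀ m ∈ piAntidiag (univ : Finset V) t,
      (∏ i, (if i ∈ e then w e else 0) ^ m i) *
        closedWalks ℂ (t * (#e - 1)) (∑ i, m i • star e i) ≠ 0 →
      t = #e ∧ m = fun i ↦ if i ∈ e then 1 else 0 := fun m hm hne ↦ by
    obtain ⟨hprod, hwalk⟩ := mul_ne_zero_iff.mp hne
    refine eq_and_eq_indicator_of_closedWalks_ne_zero (by omega) rfl ht₀ ht
      (mem_piAntidiag.mp hm).1 (fun i hi ↦ ?_) hwalk
    by_contra hie
    exact prod_ne_zero_iff.mp hprod i (mem_univ i) (by simp [hie, hi])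
  split_ifs with htk
  · subst htk
    rw [sum_eq_single fun i ↦ if i ∈ e then 1 else 0]
    · exact prod_pow_mul_closedWalks_indicator hk (w e)
    · intro m hm hne
      by_contra h
      exact hne (hunique m hm (right_ne_zero_of_mul h)).2
    · simp
  · refine sum_eq_zero fun m hm ↦ ?_
    by_contra h
    exact htk (hunique m hm (right_ne_zero_of_mul h)).1

theorem trace_diagonal_add_ofWeight (hk : 2 ≤ k) (d : V → ℂ) {w : Finset V → ℂ}
    (hw : ∀ e, w e ≠ 0 → #e = k) {t : ℕ} (ht₀ : t ≠ 0) (ht : t ≤ k) :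
    trace t (diagonal k d + ofWeight k w : Tensor k V) =
      ((k : ℂ) - 1) ^ ((Fintype.card V : ℤ) - 1) * (∑ v, d v ^ t +
        if t = k then (∑ e, w e ^ k) * ((k : ℂ) ^ (k - 1) * ((k : ℂ) - 1) ^ (1 - (k : ℤ)))
        else 0) := by
  have hterm : ∀ m ∈ piAntidiag (univ : Finset V) t,
      apolarPairing (∏ i, rowPoly (diagonal k d + ofWeight k w : Tensor k V) i ^ m i)
        (Matrix.mvPolynomialX V V ℂ ^ (t * (k - 1))).trace =
      ∑ c, (∏ i, termCoeff d w i c ^ m i) *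
        closedWalks ℂ (t * (k - 1)) (∑ i, m i • termArcs k i c) := fun m hm ↦ by
    have hsum : ∑ i, m i = t := (mem_piAntidiag.mp hm).1
    exact apolarPairing_prod_rowPoly_pow (by omega) d hw (by omega) (by omega) _
  rw [trace_eq_sum_apolarPairing, sum_congr rfl fun m hm ↦ by rw [hterm m hm, mul_sum], sum_comm,
    Fintype.sum_option]
  congr 2
  · simp only [termCoeff, termArcs, Finsupp.smul_single, smul_eq_mul]
    exact sum_prod_pow_mul_closedWalks_loops hk d t
  · simp only [termCoeff, termArcs]
    rw [sum_congr rfl fun e _ ↦ sum_prod_pow_mul_closedWalks_star hk hw e ht₀ ht, sum_mul]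
    split_ifs
    · rfl
    · exact sum_const_zero

end Tensor

section Hypergraph

variable {α : Type*} (H : Hypergraph α) [Fintype H.vertexSet]

open Classical in
/-- The edges of `H`, as finite sets of elements of the subtype of vertices, which is the index
set of the tensors of `H`. -/
noncomputable def hyperedgeFinset : Finset (Finset H.vertexSet) :=
  {s | Subtype.val '' (s : Set H.vertexSet) ∈ H.edgeSet}

variable {H}

theorem mem_hyperedgeFinset {s : Finset H.vertexSet} :
    s ∈ hyperedgeFinset H ↔ Subtype.val '' (s : Set H.vertexSet) ∈ H.edgeSet := by
  simp [hyperedgeFinset]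

theorem card_of_mem_hyperedgeFinset {k : ℕ} (hH : H.IsUniform k) {s : Finset H.vertexSet}
    (hs : s ∈ hyperedgeFinset H) : #s = k := by
  rw [← (hH _ (mem_hyperedgeFinset.mp hs)).2, Set.ncard_image_of_injective _
    Subtype.val_injective, Set.ncard_coe_finset]

variable (H) in
theorem card_hyperedgeFinset : #(hyperedgeFinset H) = H.edgeSet.ncard := by
  classical
  have himage : (fun s : Finset H.vertexSet ↦ Subtype.val '' (s : Set H.vertexSet)) ''
      hyperedgeFinset H = H.edgeSet := by
    refine Set.Subset.antisymm (Set.image_subset_iff.mpr fun s ↦ mem_hyperedgeFinset.mp) ?_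
    intro e he
    have hval : Subtype.val '' ((Subtype.val ⁻¹' e : Set H.vertexSet).toFinset : Set H.vertexSet) =
        e := by
      rw [Set.coe_toFinset, Subtype.image_preimage_coe,
        Set.inter_eq_right.mpr (H.subset_vertexSet_of_mem_edgeSet' he)]
    exact ⟨_, mem_hyperedgeFinset.mpr (hval.symm ▸ he), hval⟩
  have hinj : Function.Injective
      fun s : Finset H.vertexSet ↦ Subtype.val '' (s : Set H.vertexSet) :=
    Subtype.val_injective.image_injective.comp coe_injective
  rw [← himage, Set.ncard_image_of_injective _ hinj, Set.ncard_coe_finset]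

variable [DecidableEq H.vertexSet]

variable (H) in
omit [Fintype H.vertexSet] in
theorem degTensor_eq_diagonal (k : ℕ) :
    H.degTensor k = Tensor.diagonal k fun v : H.vertexSet ↦ (H.degree v : ℂ) := by
  ext i y
  unfold Hypergraph.degTensor Tensor.diagonal
  congr

variable (H) in
theorem smul_adjTensor_eq_ofWeight (k : ℕ) (ε : ℂ) :
    ε • H.adjTensor k =
      Tensor.ofWeight k fun e ↦ if e ∈ hyperedgeFinset H then ε else 0 := by
  ext i y
  have hval : Subtype.val '' ((insert i (univ.image y) : Finset H.vertexSet) : Set H.vertexSet) =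
      insert (i : α) (Set.range fun j ↦ (y j : α)) := by
    rw [coe_insert, Set.image_insert_eq, coe_image, coe_univ, Set.image_univ, ← Set.range_comp,
      Function.comp_def]
  simp only [Pi.smul_apply, smul_eq_mul, Hypergraph.adjTensor, Tensor.ofWeight, mul_ite, mul_zero,
    mul_one_div, ite_div, zero_div]
  classical exact if_congr (by rw [mem_hyperedgeFinset, hval]) rfl rfl

namespace Tensor

variable {k : ℕ} (hk : 2 ≤ k) (hH : H.IsUniform k) (ε : ℂ)
include hk hH

theorem trace_degTensor_add_smul_adjTensor {t : ℕ} (ht₀ : t ≠ 0) (ht : t ≤ k) :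
    trace t (H.degTensor k + ε • H.adjTensor k) =
      ((k : ℂ) - 1) ^ ((Fintype.card H.vertexSet : ℤ) - 1) *
        (∑ v : H.vertexSet, (H.degree v : ℂ) ^ t +
          if t = k then H.edgeSet.ncard * ε ^ k *
            ((k : ℂ) ^ (k - 1) * ((k : ℂ) - 1) ^ (1 - (k : ℤ))) else 0) := by
  have hsum : ∑ e, (if e ∈ hyperedgeFinset H then ε else 0) ^ k = H.edgeSet.ncard * ε ^ k := by
    simp [ite_pow, show k ≠ 0 by omega, card_hyperedgeFinset]
  rw [degTensor_eq_diagonal, smul_adjTensor_eq_ofWeight,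
    trace_diagonal_add_ofWeight hk _ (fun e he ↦ card_of_mem_hyperedgeFinset hH
      (by_contra fun h ↦ he (if_neg h))) ht₀ ht, hsum]

theorem trace_degTensor_add_smul_adjTensor_of_lt {t : ℕ} (ht₀ : t ≠ 0) (ht : t < k) :
    trace t (H.degTensor k + ε • H.adjTensor k) =
      ((k : ℂ) - 1) ^ ((Fintype.card H.vertexSet : ℤ) - 1) *
        ∑ v : H.vertexSet, (H.degree v : ℂ) ^ t := by
  rw [trace_degTensor_add_smul_adjTensor hk hH ε ht₀ ht.le, if_neg ht.ne, add_zero]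

theorem trace_self_degTensor_add_smul_adjTensor :
    trace k (H.degTensor k + ε • H.adjTensor k) =
      ε ^ k * (k : ℂ) ^ (k - 1) *
          ((k : ℂ) - 1) ^ ((Fintype.card H.vertexSet : ℤ) - (k : ℤ)) * (H.edgeSet.ncard : ℂ) +
        ((k : ℂ) - 1) ^ ((Fintype.card H.vertexSet : ℤ) - 1) *
          ∑ v : H.vertexSet, (H.degree v : ℂ) ^ k := by
  have hk₁ : (k : ℂ) - 1 ≠ 0 := sub_ne_zero.mpr (Nat.cast_ne_one.mpr (by omega))
  have hexp : (Fintype.card H.vertexSet : ℤ) - k =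
      ((Fintype.card H.vertexSet : ℤ) - 1) + (1 - (k : ℤ)) := by ring
  rw [trace_degTensor_add_smul_adjTensor hk hH ε (by omega) le_rfl, if_pos rfl, hexp,
    zpow_add₀ hk₁]
  ring

end Tensor

end Hypergraph

theorem theorem2p3 {α : Type*} [DecidableEq α] (H : Hypergraph α) [Fintype H.vertexSet]
    (k n : ℕ) (hk : 2 ≤ k) (hn : Fintype.card H.vertexSet = n) (hH : H.IsUniform k) :
    (∀ t : ℕ, 1 ≤ t → t ≤ k - 1 →
      Tensor.trace t (H.laplacianTensor k) =
          ((k : ℂ) - 1) ^ ((n : ℤ) - 1) * ∑ v : H.vertexSet, (H.degree v : ℂ) ^ t ∧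
      Tensor.trace t (H.signlessLaplacianTensor k) =
          ((k : ℂ) - 1) ^ ((n : ℤ) - 1) * ∑ v : H.vertexSet, (H.degree v : ℂ) ^ t) ∧
    Tensor.trace k (H.laplacianTensor k) =
      (-1) ^ k * (k : ℂ) ^ (k - 1) * ((k : ℂ) - 1) ^ ((n : ℤ) - (k : ℤ)) * (H.edgeSet.ncard : ℂ) +
        ((k : ℂ) - 1) ^ ((n : ℤ) - 1) * ∑ v : H.vertexSet, (H.degree v : ℂ) ^ k ∧
    Tensor.trace k (H.signlessLaplacianTensor k) =
      (k : ℂ) ^ (k - 1) * ((k : ℂ) - 1) ^ ((n : ℤ) - (k : ℤ)) * (H.edgeSet.ncard : ℂ) +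
        ((k : ℂ) - 1) ^ ((n : ℤ) - 1) * ∑ v : H.vertexSet, (H.degree v : ℂ) ^ k := by
  subst hn
  have hL : H.laplacianTensor k = H.degTensor k + (-1 : ℂ) • H.adjTensor k := by
    rw [Hypergraph.laplacianTensor, neg_one_smul, sub_eq_add_neg]
  have hQ : H.signlessLaplacianTensor k = H.degTensor k + (1 : ℂ) • H.adjTensor k := by
    rw [Hypergraph.signlessLaplacianTensor, one_smul]
  rw [hL, hQ]
  refine ⟨fun t ht₀ ht ↦ ⟨?_, ?_⟩, ?_, ?_⟩
  · exact Tensor.trace_degTensor_add_smul_adjTensor_of_lt hk hH (-1) (by omega) (by omega)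
  · exact Tensor.trace_degTensor_add_smul_adjTensor_of_lt hk hH 1 (by omega) (by omega)
  · exact Tensor.trace_self_degTensor_add_smul_adjTensor hk hH (-1)
  · rw [Tensor.trace_self_degTensor_add_smul_adjTensor hk hH 1, one_pow, one_mul]
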